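/- For $m\ge 0$ let $$G_m=\langle x_1,\dots,x_m \mid x_i^{-1}x_j^2x_ix_j^2\ \ (1\le i,j\le m,\ i\ne j)\rangle .$$ A (closed) flat $n$-manifold is an orbit space $M=\mathbb R^n/\Delta$, where $\Delta$ is a group of isometries of Euclidean space $\mathbb R^n$ acting freely, properly discontinuously and cocompactly; its holonomy group is the group of linear parts of elements of $\Delta$, and $M$ is orientable if all these linear parts have positive determinant. A Hantzsche–Wendt group of dimension $n$ is a group $\Gamma$ isomorphic to the fundamental group of an orientable flat $n$-manifold with holonomy group isomorphic to $(\mathbb Z/2)^{n-1}$. Call $\beta_1,\dots,\beta_n\in\Gamma$ standard generators if they generate $\Gamma$ and if $\Gamma$ can be faithfully represented by isometries $(B,b)\colon v\mapsto Bv+b$ of $\mathbb R^n$ in such a way that $\beta_i=(B_i,b_i)$, where $B_i$ is the diagonal matrix with $(i,i)$ entry $1$ and all other diagonal entries $-1$, all coordinates of $b_i$ lie in $\{0,\tfrac12\}$, $\beta_i^2$ is the translation by the $i$-th standard basis vector, and the subgroup of all translations in $\Gamma$ is $\langle\beta_1^2,\dots,\beta_n^2\rangle$. Theorem. Let $n\ge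 2$ and let $\Gamma$ be a Hantzsche–Wendt group of dimension $n$. Then $\Gamma$ has standard generators, and for every choice of standard generators $\beta_1,\dots,\beta_n$ of $\Gamma$ there is a surjective homomorphism $\Phi\colon G_{n-1}\to\Gamma$ with $\Phi(x_i)=\beta_i$ for $1\le i\le n-1$, and $\ker\Phi$ is a free group. -/

import Mathlib

namespace HantzscheWendt

/-- Euclidean `n`-space. -/
abbrev Euc (n : ℕ) : Type := EuclideanSpace ℝ (Fin n)

/-- The group of isometries of Euclidean `n`-space. -/
abbrev Isom (n : ℕ) : Type := Euc n ≃ᵃⁱ[ℝ] Euc n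

noncomputable instance isomAction (n : ℕ) : MulAction (Isom n) (Euc n) where
  smul g v := g v
  one_smul _ := rfl
  mul_smul _ _ _ := rfl

/-- The linear part `(B, b) ↦ B` of an isometry `v ↦ B v + b`. -/
noncomputable def linearPart (n : ℕ) : Isom n →* (Euc n ≃ₗᵢ[ℝ] Euc n) where
  toFun g := g.linearIsometryEquiv
  map_one' := rfl
  map_mul' _ _ := rfl

/-- A (closed, connected) flat `n`-manifold, presented as the orbit space of Euclidean `n`-space
under a group `deck` of isometries that acts freely, properly discontinuously and cocompactly. -/
structure FlatManifold (n : ℕ) where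
  /-- the group of deck transformations of the universal covering -/
  deck : Subgroup (Isom n)
  free : ∀ g ∈ deck, ∀ v : Euc n, g v = v → g = 1
  properlyDiscontinuous : ProperlyDiscontinuousSMul deck (Euc n)
  cocompact : CompactSpace (MulAction.orbitRel.Quotient deck (Euc n))

namespace FlatManifold

variable {n : ℕ} (M : FlatManifold n)

/-- The underlying topological space of the manifold, with the quotient topology. -/
abbrev Carrier : Type := MulAction.orbitRel.Quotient M.deck (Euc n)

/-- The holonomy group: the group of linear parts of the deck transformations. -/
noncomputable def holonomy : Subgroup (Euc n ≃ₗᵢ[ℝ] Euc n) := M.deck.map (linearPart n)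

/-- The manifold is orientable: every deck transformation preserves the orientation of
Euclidean space. -/
def Orientable : Prop :=
  ∀ g ∈ M.deck, 0 < LinearMap.det ((linearPart n g).toLinearEquiv : Euc n →ₗ[ℝ] Euc n)

end FlatManifold

/-- `Γ` is a Hantzsche–Wendt group of dimension `n`: it is isomorphic to the fundamental group of
an orientable flat `n`-manifold whose holonomy group is isomorphic to `(ℤ/2)^(n-1)`. -/
def IsHWGroup (n : ℕ) (Γ : Type*) [Group Γ] : Prop :=
  ∃ M : FlatManifold n, M.Orientable ∧
    Nonempty (M.holonomy ≃* Multiplicative (Fin (n - 1) → ZMod 2)) ∧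
    ∃ p : M.Carrier, Nonempty (Γ ≃* FundamentalGroup M.Carrier p)

/-- The elements `β 0, …, β (n-1)` are standard generators of `Γ`: they generate `Γ`, and `Γ` has
a faithful representation `ρ` by isometries of Euclidean `n`-space such that
* `ρ (β i) = (B i, b i)`, where `B i` is the diagonal matrix with entry `1` in place `(i, i)` and
  all other diagonal entries `-1`, where all coordinates of `b i` lie in `{0, 1/2}`, and where
  `(β i)²` is the translation by the `i`-th standard basis vector;
* the translation subgroup of `Γ` is generated by the squares `(β i)²`. -/
def IsStandardGenerators {n : ℕ} {Γ : Type*} [Group Γ] (β : Fin n → Γ) : Prop :=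
  Subgroup.closure (Set.range β) = ⊤ ∧
  ∃ ρ : Γ →* Isom n, Function.Injective ρ ∧
    (∃ b : Fin n → Fin n → ℝ, (∀ i j, b i j = 0 ∨ b i j = 1 / 2) ∧
      ∀ i (v : Euc n) j, ρ (β i) v j = (if j = i then v j else - v j) + b i j) ∧
    (∀ i (v : Euc n), ρ (β i ^ 2) v = v + EuclideanSpace.single i 1) ∧
    ((linearPart n).comp ρ).ker = Subgroup.closure (Set.range fun i => β i ^ 2)

/-- The relators `x_i⁻¹ x_j² x_i x_j²`, `i ≠ j`. -/
def chwRelators (n : ℕ) : Set (FreeGroup (Fin n)) :=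
  {r | ∃ i j : Fin n, i ≠ j ∧
    r = (FreeGroup.of i)⁻¹ * FreeGroup.of j ^ 2 * FreeGroup.of i * FreeGroup.of j ^ 2}

/-- The combinatorial generalized Hantzsche–Wendt group `G_n`. -/
abbrev CHW (n : ℕ) : Type := PresentedGroup (chwRelators n)

/-- The generators of `G_n`. -/
def CHW.x {n : ℕ} (i : Fin n) : CHW n := PresentedGroup.of i

end HantzscheWendt

/-! The holonomy consists of commuting orthogonal involutions, so a common eigenbasis makes it
diagonal with entries ±1; orientability and a count identify it with all such matrices of
determinant 1. An isometry of order two fixes a midpoint, so Γ has no involutions. This excludes -I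
from the holonomy, whence n is odd and every B_i occurs.

Standard generators exist because an element over B_i squares to a translation along the i-th axis,
which must be an odd multiple of the shortest one: otherwise a translation would correct the element
to an involution. Scaling the axes, moving the origin and reducing modulo the lattice gives the
normal form (`exists_isStandardGenerators`).

The relations hold since β_i inverts translations along the other axes. For surjectivity
(`mem_closure_of_ne`), let H be generated by the β_i with i ≠ l. As n is odd, H has an element over
B_l. If all these β_i reflected the l-th coordinate in the same point, that element would be an
involution. So two of them differ there, and their product squares to a translation with l-th
coordinate 1. Thus H contains the whole lattice, hence β_l.

For the kernel, let A be the normal abelian subgroup of G generated by the x_i². Φ sends these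
squares to independent translations, so ker Φ ∩ A = 1 and ker Φ embeds in G/A, a free product of
groups of order 2. The last sign of Φ(w) is the parity of the length of w, so the image lies in the
free subgroup of even words; Nielsen–Schreier finishes. -/

namespace HantzscheWendt

/-! ### Sign vectors and diagonal affine actions. -/

/-- The sign pattern with entry `1` in place `i` and all other entries `-1`. -/
def signPattern {n : ℕ} (i : Fin n) : Fin n → ℤˣ := fun j => if j = i then 1 else -1

lemma signPattern_self {n : ℕ} (i : Fin n) : signPattern i i = 1 := if_pos rfl

lemma signPattern_of_ne {n : ℕ} {i j : Fin n} (h : j ≠ i) : signPattern i j = -1 := if_neg h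

lemma signPattern_ne_one {n : ℕ} (hn : 2 ≤ n) (i : Fin n) : signPattern i ≠ 1 := by
  have : Nontrivial (Fin n) := Fin.nontrivial_iff_two_le.2 hn
  obtain ⟨j, hj⟩ := exists_ne i
  intro h
  have := congrFun h j
  rw [signPattern_of_ne hj, Pi.one_apply] at this
  exact absurd this (by decide)

lemma prod_signPattern {n : ℕ} (hn : Odd n) (i : Fin n) : ∏ j, signPattern i j = 1 := by
  rw [← Finset.mul_prod_erase _ _ (Finset.mem_univ i), signPattern_self, one_mul,
    Finset.prod_congr rfl (fun j hj => signPattern_of_ne (Finset.ne_of_mem_erase hj)),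
    Finset.prod_const, Finset.card_erase_of_mem (Finset.mem_univ i), Finset.card_univ,
    Fintype.card_fin]
  exact (Nat.Odd.sub_odd hn odd_one).neg_one_pow

/-- A sign vector with product `1` is the product of the patterns at its negative entries. -/
lemma eq_prod_signPattern {n : ℕ} (s : Fin n → ℤˣ) (hs : ∏ j, s j = 1) :
    s = ∏ i, if s i = 1 then 1 else signPattern i := by
  funext j
  -- In coordinate `j` the factor `i = j` is 1 and every other factor is `s i`; their product is `s
  -- j` because all signs multiply to 1.
  rw [Finset.prod_apply, ← Finset.mul_prod_erase _ _ (Finset.mem_univ j)]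
  rw [← Finset.mul_prod_erase _ _ (Finset.mem_univ j)] at hs
  have h1 : (if s j = 1 then (1 : Fin n → ℤˣ) else signPattern j) j = 1 := by
    split_ifs
    · rfl
    · exact signPattern_self j
  rw [h1, one_mul, eq_comm, Finset.prod_congr rfl (g := s)]
  · rw [mul_eq_one_iff_eq_inv] at hs
    rw [hs, Int.units_inv_eq_self]
  · intro i hi
    rcases Int.units_eq_one_or (s i) with h | h
    · simp [h]
    · have : j ≠ i := (Finset.ne_of_mem_erase hi).symm
      simp [h, signPattern_of_ne this]

/-- Only the patterns at negative entries of `s` are needed, so for odd `n` the pattern at `l` comes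
from all the others. -/
lemma mem_of_signPattern_mem {n : ℕ} (H : Subgroup (Fin n → ℤˣ)) (s : Fin n → ℤˣ)
    (hs : ∏ j, s j = 1) (h : ∀ i, s i = -1 → signPattern i ∈ H) : s ∈ H := by
  rw [eq_prod_signPattern s hs]
  refine Subgroup.prod_mem _ fun i _ => ?_
  split_ifs with hi
  · exact one_mem _
  · exact h i ((Int.units_eq_one_or _).resolve_left hi)

/-- A faithful action of `Γ` on `ℝⁿ` by affine maps `v ↦ (sgn g j * v j + tr g j)_j` whose linear
parts are diagonal with entries `±1`. -/
structure DiagonalAction (n : ℕ) (Γ : Type*) [Group Γ] where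
  /-- the linear part -/
  sgn : Γ →* (Fin n → ℤˣ)
  /-- the translational part -/
  tr : Γ → Fin n → ℝ
  tr_mul : ∀ g h j, tr (g * h) j = ((sgn g j : ℤ) : ℝ) * tr h j + tr g j
  faithful : ∀ g, sgn g = 1 → tr g = 0 → g = 1

namespace DiagonalAction

variable {n : ℕ} {Γ : Type*} [Group Γ] (D : DiagonalAction n Γ)

lemma tr_one : D.tr 1 = 0 := by
  funext j
  have := D.tr_mul 1 1 j
  simpa using this

lemma tr_mul_of_sgn_eq_one {g : Γ} (hg : D.sgn g = 1) (h : Γ) :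
    D.tr (g * h) = D.tr g + D.tr h := by
  funext j
  simp [D.tr_mul, hg, add_comm]

lemma tr_inv_of_sgn_eq_one {g : Γ} (hg : D.sgn g = 1) : D.tr g⁻¹ = - D.tr g := by
  have := D.tr_mul_of_sgn_eq_one hg g⁻¹
  rw [mul_inv_cancel, D.tr_one] at this
  exact (neg_eq_of_add_eq_zero_right this.symm).symm

lemma ext_of_eq {g h : Γ} (hs : D.sgn g = D.sgn h) (ht : D.tr g = D.tr h) : g = h := by
  refine mul_inv_eq_one.1 (D.faithful _ (by simp [hs]) ?_)
  funext j
  have h1 := D.tr_mul (g * h⁻¹) h j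
  rw [inv_mul_cancel_right, ht] at h1
  simpa [hs] using h1

lemma sgn_sq (g : Γ) : D.sgn (g ^ 2) = 1 := by
  rw [map_pow]
  funext j
  simp [Int.units_sq]

lemma tr_sq_of_one {g : Γ} {j : Fin n} (h : D.sgn g j = 1) : D.tr (g ^ 2) j = 2 * D.tr g j := by
  rw [pow_two, D.tr_mul, h]
  simp
  ring

lemma tr_sq_of_neg {g : Γ} {j : Fin n} (h : D.sgn g j = -1) : D.tr (g ^ 2) j = 0 := by
  rw [pow_two, D.tr_mul, h]
  simp

lemma tr_sq_signPattern {g : Γ} {i : Fin n} (h : D.sgn g = signPattern i) :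
    D.tr (g ^ 2) = Pi.single i (2 * D.tr g i) := by
  funext j
  by_cases hj : j = i
  · subst hj
    rw [D.tr_sq_of_one (by rw [h, signPattern_self]), Pi.single_eq_same]
  · rw [D.tr_sq_of_neg (by rw [h, signPattern_of_ne hj]), Pi.single_eq_of_ne hj]

/-- In a group without involutions, an element whose linear part is a sign pattern acts without
fixed points. -/
lemma tr_ne_zero_of_signPattern (hn : 2 ≤ n) (hΓ : ∀ g : Γ, g ^ 2 = 1 → g = 1) {g : Γ} {i : Fin n}
    (h : D.sgn g = signPattern i) : D.tr g i ≠ 0 := by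
  intro h0
  have : g = 1 := hΓ g (D.faithful _ (D.sgn_sq g) (by rw [D.tr_sq_signPattern h, h0]; simp))
  rw [this, map_one] at h
  exact signPattern_ne_one hn i h.symm

/-- The lattice of translation vectors of elements of a subgroup. -/
def translations (P : Subgroup Γ) : AddSubgroup (Fin n → ℝ) where
  carrier := {t | ∃ g ∈ P, D.sgn g = 1 ∧ D.tr g = t}
  zero_mem' := ⟨1, one_mem _, map_one _, D.tr_one⟩
  add_mem' := by
    rintro _ _ ⟨g, hg, hs, rfl⟩ ⟨g', hg', hs', rfl⟩
    exact ⟨g * g', mul_mem hg hg', by rw [map_mul, hs, hs', one_mul],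
      D.tr_mul_of_sgn_eq_one hs g'⟩
  neg_mem' := by
    rintro _ ⟨g, hg, hs, rfl⟩
    exact ⟨g⁻¹, inv_mem hg, by rw [map_inv, hs, inv_one], D.tr_inv_of_sgn_eq_one hs⟩

lemma mem_of_tr_mem {P : Subgroup Γ} {g : Γ} (hg : D.sgn g = 1) (h : D.tr g ∈ D.translations P) :
    g ∈ P := by
  obtain ⟨g', hP, hs, ht⟩ := h
  rwa [← D.ext_of_eq (hs.trans hg.symm) ht]

/-- The same action in the affine coordinates `(v j - w j) / c j`. -/
noncomputable def rescale (c w : Fin n → ℝ) (hc : ∀ j, c j ≠ 0) : DiagonalAction n Γ where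
  sgn := D.sgn
  tr g j := (D.tr g j - (1 - ((D.sgn g j : ℤ) : ℝ)) * w j) / c j
  tr_mul g h j := by
    rw [D.tr_mul, map_mul]
    have := hc j
    field_simp
    push_cast [Pi.mul_apply, Units.val_mul]
    ring
  faithful g hg ht := by
    refine D.faithful g hg (funext fun j => ?_)
    have := congrFun ht j
    simpa [hg, hc j] using this

end DiagonalAction

/-- An additive subgroup of `ℝⁿ` containing the standard basis contains all integral vectors. -/
lemma mem_of_single_mem {n : ℕ} (S : AddSubgroup (Fin n → ℝ))
    (h : ∀ i, Pi.single i (1 : ℝ) ∈ S) (t : Fin n → ℝ) (ht : ∀ j, ∃ k : ℤ, t j = k) : t ∈ S := by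
  choose z hz using ht
  have : t = ∑ i, z i • Pi.single i (1 : ℝ) := by
    funext j
    simp [Finset.sum_apply, Pi.single_apply, hz]
  rw [this]
  exact AddSubgroup.sum_mem _ fun i _ => AddSubgroup.zsmul_mem _ (h i) _

end HantzscheWendt

/-! ### Existence of standard generators. -/

namespace HantzscheWendt

/-- The linear isometry of Euclidean space with diagonal entries `s`. -/
noncomputable def signIsometry {n : ℕ} (s : Fin n → ℤˣ) : Euc n ≃ₗᵢ[ℝ] Euc n :=
  LinearIsometryEquiv.piLpCongrRight 2 fun j =>
    if s j = 1 then LinearIsometryEquiv.refl ℝ ℝ else LinearIsometryEquiv.neg ℝ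

lemma signIsometry_apply {n : ℕ} (s : Fin n → ℤˣ) (v : Euc n) (j : Fin n) :
    signIsometry s v j = ((s j : ℤ) : ℝ) * v j := by
  rcases Int.units_eq_one_or (s j) with h | h <;> simp [signIsometry, h]

/-- The isometry `v ↦ (s j * v j + t j)_j`. -/
noncomputable def diagIsom {n : ℕ} (s : Fin n → ℤˣ) (t : Fin n → ℝ) : Isom n :=
  (signIsometry s).toAffineIsometryEquiv.trans
    (AffineIsometryEquiv.constVAdd ℝ (Euc n) (WithLp.toLp 2 t))

lemma diagIsom_apply {n : ℕ} (s : Fin n → ℤˣ) (t : Fin n → ℝ) (v : Euc n) (j : Fin n) :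
    diagIsom s t v j = ((s j : ℤ) : ℝ) * v j + t j := by
  simp [diagIsom, signIsometry_apply, add_comm]

lemma linearPart_diagIsom {n : ℕ} (s : Fin n → ℤˣ) (t : Fin n → ℝ) :
    linearPart n (diagIsom s t) = signIsometry s := by
  ext v : 1
  have h : (linearPart n (diagIsom s t)) v = diagIsom s t v -ᵥ diagIsom s t 0 := by
    have := (diagIsom s t).map_vadd 0 v
    rw [vadd_eq_add, add_zero] at this
    rw [this, vadd_vsub]
    rfl
  rw [h]
  ext j
  simp [diagIsom_apply, signIsometry_apply]

lemma signIsometry_eq_one_iff {n : ℕ} (s : Fin n → ℤˣ) : signIsometry s = 1 ↔ s = 1 := by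
  constructor
  · intro h
    funext j
    have := signIsometry_apply s (EuclideanSpace.single j 1) j
    rw [h] at this
    simp at this
    rcases Int.units_eq_one_or (s j) with h | h
    · exact h
    · rw [h] at this
      norm_num at this
  · rintro rfl
    ext v j
    simp [signIsometry_apply]

namespace DiagonalAction

variable {n : ℕ} {Γ : Type*} [Group Γ] (D : DiagonalAction n Γ)

/-- The representation by isometries of a diagonal action. -/
noncomputable def toIsom : Γ →* Isom n where
  toFun g := diagIsom (D.sgn g) (D.tr g)
  map_one' := by
    ext v j
    simp [diagIsom_apply, D.tr_one]
  map_mul' g h := by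
    ext v j
    change _ = diagIsom (D.sgn g) (D.tr g) (diagIsom (D.sgn h) (D.tr h) v) j
    simp only [diagIsom_apply, D.tr_mul, map_mul, Pi.mul_apply, Units.val_mul, Int.cast_mul]
    ring

lemma toIsom_apply (g : Γ) (v : Euc n) (j : Fin n) :
    D.toIsom g v j = ((D.sgn g j : ℤ) : ℝ) * v j + D.tr g j := diagIsom_apply _ _ _ _

lemma linearPart_toIsom_eq_one_iff (g : Γ) : linearPart n (D.toIsom g) = 1 ↔ D.sgn g = 1 := by
  rw [← signIsometry_eq_one_iff, ← linearPart_diagIsom (D.sgn g) (D.tr g)]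
  rfl

lemma toIsom_injective : Function.Injective D.toIsom := by
  refine (injective_iff_map_eq_one _).2 fun g hg => ?_
  have hs : D.sgn g = 1 := by rw [← D.linearPart_toIsom_eq_one_iff, hg, map_one]
  refine D.faithful g hs (funext fun j => ?_)
  have := D.toIsom_apply g 0 j
  rw [hg] at this
  simpa using this.symm

/-- If `Γ` has no involutions and all diagonal matrices of determinant one occur as linear parts,
then the dimension is odd. -/
lemma odd_of_no_involution (hn : 2 ≤ n) (hΓ : ∀ g : Γ, g ^ 2 = 1 → g = 1)
    (hsurj : ∀ s : Fin n → ℤˣ, ∏ j, s j = 1 → ∃ g, D.sgn g = s) : Odd n := by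
  by_contra h
  -- For even `n` some element has linear part -I; it squares to the identity.
  obtain ⟨g, hg⟩ := hsurj (-1) (by
    simp [(Nat.not_odd_iff_even.1 h).neg_one_pow])
  have h1 : g = 1 := hΓ g (D.faithful _ (D.sgn_sq g) (funext fun j => D.tr_sq_of_neg (by simp [hg])))
  rw [h1, map_one] at hg
  have := congrFun hg ⟨0, by omega⟩
  simp at this

/-- Normalization of the translations along the axes. -/
lemma exists_rescale (hn : 2 ≤ n) (hΓ : ∀ g : Γ, g ^ 2 = 1 → g = 1)
    (hsurj : ∀ s : Fin n → ℤˣ, ∏ j, s j = 1 → ∃ g, D.sgn g = s)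
    (hdisc : ∀ i, ∃ c : ℝ, ∀ x : ℝ,
      Pi.single i x ∈ D.translations ⊤ ↔ ∃ k : ℤ, x = k * c) :
    ∃ D' : DiagonalAction n Γ, D'.sgn = D.sgn ∧
      (∀ i x, Pi.single i x ∈ D'.translations ⊤ → ∃ k : ℤ, x = k) ∧
      ∃ a : Fin n → Γ, ∀ i, D'.sgn (a i) = signPattern i ∧ D'.tr (a i) i = 1 / 2 := by
  have hodd := D.odd_of_no_involution hn hΓ hsurj
  choose c hc using hdisc
  have ha : ∀ i, ∃ a, D.sgn a = signPattern i ∧ D.tr a i = c i / 2 := by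
    intro i
    obtain ⟨a, ha⟩ := hsurj (signPattern i) (prod_signPattern hodd i)
    obtain ⟨k, hk⟩ := (hc i _).1 ⟨a ^ 2, trivial, D.sgn_sq a, D.tr_sq_signPattern ha⟩
    have key : ∀ m : ℤ, ∃ a', D.sgn a' = signPattern i ∧ D.tr a' i = D.tr a i - m * c i := by
      intro m
      obtain ⟨g, -, hs, ht⟩ := (hc i (m * c i)).2 ⟨m, rfl⟩
      refine ⟨g⁻¹ * a, by simp [hs, ha], ?_⟩
      rw [D.tr_mul_of_sgn_eq_one (by simp [hs]), D.tr_inv_of_sgn_eq_one hs, ht]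
      simp
      ring
    -- Here `2 * D.tr a i = k * c i`. If `k = 2m`, subtracting `m * c i` leaves no translation along
    -- the axis, hence an involution; if `k = 2m + 1`, it leaves `c i / 2`.
    rcases Int.even_or_odd' k with ⟨m, rfl | rfl⟩
    · obtain ⟨a', ha', ht⟩ := key m
      refine absurd ?_ (D.tr_ne_zero_of_signPattern hn hΓ ha')
      rw [ht]
      push_cast at hk
      linarith
    · obtain ⟨a', ha', ht⟩ := key m
      refine ⟨a', ha', ?_⟩
      rw [ht]
      push_cast at hk
      linarith
  choose a ha ht using ha
  have hc0 : ∀ i, c i ≠ 0 := fun i h =>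
    D.tr_ne_zero_of_signPattern hn hΓ (ha i) (by rw [ht, h, zero_div])
  refine ⟨D.rescale c 0 hc0, rfl, ?_, a, fun i => ⟨ha i, ?_⟩⟩
  · rintro i x ⟨g, -, hs, hx⟩
    have : Pi.single i (x * c i) ∈ D.translations ⊤ := by
      refine ⟨g, trivial, hs, funext fun j => ?_⟩
      have h1 : D.tr g j / c j = Pi.single (M := fun _ => ℝ) i x j := by
        simpa [rescale] using congrFun hx j
      rw [div_eq_iff (hc0 j)] at h1
      rw [h1]
      by_cases hj : j = i
      · subst hj; simp
      · simp [hj]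
    obtain ⟨k, hk⟩ := (hc i _).1 this
    exact ⟨k, mul_right_cancel₀ (hc0 i) hk⟩
  · have := hc0 i
    simp [rescale, ht]
    field_simp

/-- In normalized coordinates all translations are integral. -/
lemma tr_integral (hn : 2 ≤ n) (hΓ : ∀ g : Γ, g ^ 2 = 1 → g = 1)
    (hint : ∀ i x, Pi.single i x ∈ D.translations ⊤ → ∃ k : ℤ, x = k)
    (a : Fin n → Γ) (ha : ∀ i, D.sgn (a i) = signPattern i) (ht : ∀ i, D.tr (a i) i = 1 / 2)
    (g : Γ) (hg : D.sgn g = 1) (i : Fin n) : ∃ k : ℤ, D.tr g i = k := by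
  have hs : D.sgn (g * a i) = signPattern i := by rw [map_mul, hg, one_mul, ha]
  have h1 : D.tr (g * a i) i = D.tr g i + 1 / 2 := by
    rw [D.tr_mul_of_sgn_eq_one hg, Pi.add_apply, ht]
  obtain ⟨k, hk⟩ := hint i _ ⟨_, trivial, D.sgn_sq _, D.tr_sq_signPattern hs⟩
  have hbasis : Pi.single i 1 ∈ D.translations ⊤ :=
    ⟨a i ^ 2, trivial, D.sgn_sq _, by rw [D.tr_sq_signPattern (ha i), ht]; norm_num⟩
  -- Now `2 * D.tr g i + 1 = k`; an even `k` would again allow a correction to an involution.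
  rcases Int.even_or_odd' k with ⟨m, rfl | rfl⟩
  · obtain ⟨e, -, hes, het⟩ := AddSubgroup.zsmul_mem _ hbasis (-m)
    refine absurd ?_ (D.tr_ne_zero_of_signPattern hn hΓ (g := e * (g * a i)) (i := i)
      (by rw [map_mul, hes, one_mul, hs]))
    rw [D.tr_mul_of_sgn_eq_one hes, het]
    push_cast at hk
    simp
    linarith
  · refine ⟨m, ?_⟩
    push_cast at hk
    linarith

/-- The origin can be moved so that the `a i` have half-integral translational parts. -/
lemma exists_half_integral (hn : 3 ≤ n) (a : Fin n → Γ) (ha : ∀ i, D.sgn (a i) = signPattern i)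
    (ht : ∀ i, D.tr (a i) i = 1 / 2)
    (hint : ∀ g, D.sgn g = 1 → ∀ i, ∃ k : ℤ, D.tr g i = k) :
    ∃ D' : DiagonalAction n Γ, D'.sgn = D.sgn ∧ (∀ i, D'.tr (a i) i = 1 / 2) ∧
      (∀ g, D'.sgn g = 1 → ∀ i, ∃ k : ℤ, D'.tr g i = k) ∧
      ∀ i j, ∃ k : ℤ, D'.tr (a i) j = k / 2 := by
  have : Nontrivial (Fin n) := Fin.nontrivial_iff_two_le.2 (by omega)
  -- The new origin has as `j`-th coordinate the centre of the reflection by which `a (κ j)` acts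
  -- there. The square of `a i * a (κ j)` then shows that twice the new `j`-th translation of `a i`
  -- is an integer.
  choose κ hκ using fun j : Fin n => exists_ne j
  refine ⟨D.rescale 1 (fun j => D.tr (a (κ j)) j / 2) (by simp), rfl, fun i => ?_,
    fun g hg i => ?_, fun i j => ?_⟩
  · simp [rescale, ha, signPattern_self, ht]
  · have hg' : D.sgn g = 1 := hg
    simpa [rescale, hg'] using hint g hg' i
  · by_cases hij : j = i
    · subst hij
      exact ⟨1, by simp [rescale, ha, signPattern_self, ht]⟩
    · obtain ⟨k, hk⟩ := hint _ (D.sgn_sq (a i * a (κ j))) j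
      have hs : D.sgn (a i * a (κ j)) j = 1 := by
        simp [ha, signPattern_of_ne hij, signPattern_of_ne (hκ j).symm]
      rw [D.tr_sq_of_one hs, D.tr_mul, ha, signPattern_of_ne hij] at hk
      refine ⟨k, ?_⟩
      simp [rescale, ha, signPattern_of_ne hij]
      push_cast [Units.val_neg, Units.val_one] at hk
      linarith

/-- A group without involutions that has a diagonal action with all linear parts of determinant one
and discrete translations along the axes has standard generators. -/
theorem exists_isStandardGenerators (hn : 2 ≤ n) (hΓ : ∀ g : Γ, g ^ 2 = 1 → g = 1)
    (hprod : ∀ g, ∏ j, D.sgn g j = 1)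
    (hsurj : ∀ s : Fin n → ℤˣ, ∏ j, s j = 1 → ∃ g, D.sgn g = s)
    (hdisc : ∀ i, ∃ c : ℝ, ∀ x : ℝ,
      Pi.single i x ∈ D.translations ⊤ ↔ ∃ k : ℤ, x = k * c) :
    ∃ β : Fin n → Γ, IsStandardGenerators β := by
  have hodd := D.odd_of_no_involution hn hΓ hsurj
  have hn3 : 3 ≤ n := by
    obtain ⟨k, hk⟩ := hodd
    omega
  obtain ⟨D₁, hD₁, hint₁, a, ha⟩ := D.exists_rescale hn hΓ hsurj hdisc
  obtain ⟨D₂, hD₂, ht₂, hint₂, hhalf⟩ := D₁.exists_half_integral hn3 a (fun i => (ha i).1)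
    (fun i => (ha i).2) (D₁.tr_integral hn hΓ hint₁ a (fun i => (ha i).1) (fun i => (ha i).2))
  have hsgn : D₂.sgn = D.sgn := hD₂.trans hD₁
  have has : ∀ i, D₂.sgn (a i) = signPattern i := fun i => by rw [hD₂, (ha i).1]
  have hlat : ∀ t : Fin n → ℝ, (∀ j, ∃ k : ℤ, t j = k) → t ∈ D₂.translations ⊤ :=
    mem_of_single_mem _ fun i => ⟨a i ^ 2, trivial, D₂.sgn_sq _, by
      rw [D₂.tr_sq_signPattern (has i), ht₂]; norm_num⟩
  have hβ : ∀ i, ∃ β, D₂.sgn β = signPattern i ∧ D₂.tr β i = 1 / 2 ∧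
      ∀ j, D₂.tr β j = 0 ∨ D₂.tr β j = 1 / 2 := by
    intro i
    -- Reduction modulo the lattice: half-integers in [0, 1) are 0 or 1/2.
    obtain ⟨e, -, hes, het⟩ := hlat (fun j => -(⌊D₂.tr (a i) j⌋ : ℝ))
      (fun j => ⟨-⌊D₂.tr (a i) j⌋, by simp⟩)
    have htr : ∀ j, D₂.tr (e * a i) j = Int.fract (D₂.tr (a i) j) := fun j => by
      rw [D₂.tr_mul_of_sgn_eq_one hes, het, Pi.add_apply, ← Int.self_sub_floor]
      ring
    refine ⟨e * a i, by rw [map_mul, hes, one_mul, has], ?_, fun j => ?_⟩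
    · rw [htr, ht₂, Int.fract_eq_self]
      norm_num
    · rw [htr]
      obtain ⟨k, hk⟩ := hhalf i j
      rw [hk]
      rcases Int.even_or_odd' k with ⟨m, rfl | rfl⟩
      · left
        rw [show ((2 * m : ℤ) : ℝ) / 2 = (m : ℝ) by push_cast; ring, Int.fract_intCast]
      · right
        rw [show ((2 * m + 1 : ℤ) : ℝ) / 2 = (m : ℝ) + 1 / 2 by push_cast; ring,
          Int.fract_intCast_add, Int.fract_eq_self]
        norm_num
  choose β hβs hβt hβb using hβ
  have hsq : ∀ i, D₂.tr (β i ^ 2) = Pi.single i 1 := fun i => by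
    rw [D₂.tr_sq_signPattern (hβs i), hβt]; norm_num
  have hker : ∀ g, D₂.sgn g = 1 → g ∈ Subgroup.closure (Set.range fun i => β i ^ 2) := by
    intro g hg
    refine D₂.mem_of_tr_mem hg (mem_of_single_mem _ (fun i => ?_) _ (hint₂ g hg))
    exact ⟨β i ^ 2, Subgroup.subset_closure ⟨i, rfl⟩, D₂.sgn_sq _, hsq i⟩
  have hle : Subgroup.closure (Set.range fun i => β i ^ 2) ≤ Subgroup.closure (Set.range β) := by
    rw [Subgroup.closure_le]
    rintro _ ⟨i, rfl⟩
    exact Subgroup.pow_mem _ (Subgroup.subset_closure (Set.mem_range_self i)) 2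
  refine ⟨β, ?_, D₂.toIsom, D₂.toIsom_injective, ⟨fun i => D₂.tr (β i), hβb, ?_⟩, ?_, ?_⟩
  · refine eq_top_iff.2 fun g _ => ?_
    have hmem : D₂.sgn g ∈ (Subgroup.closure (Set.range β)).map D₂.sgn :=
      mem_of_signPattern_mem _ _ (by rw [hsgn]; exact hprod g) fun i _ =>
        ⟨β i, Subgroup.subset_closure ⟨i, rfl⟩, hβs i⟩
    obtain ⟨p, hp, hpg⟩ := hmem
    have := hle (hker (p⁻¹ * g) (by rw [map_mul, map_inv, hpg, inv_mul_cancel]))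
    exact (Subgroup.mul_mem_cancel_left _ (inv_mem hp)).1 this
  · intro i v j
    rw [D₂.toIsom_apply, hβs]
    split_ifs with h
    · simp [h, signPattern_self]
    · simp [signPattern_of_ne h]
  · intro i v
    ext j
    rw [D₂.toIsom_apply, D₂.sgn_sq, hsq]
    simp [Pi.single_apply]
  · refine le_antisymm (fun g hg => hker g ((D₂.linearPart_toIsom_eq_one_iff g).1 hg)) ?_
    rw [Subgroup.closure_le]
    rintro _ ⟨i, rfl⟩
    exact (D₂.linearPart_toIsom_eq_one_iff _).2 (D₂.sgn_sq _)

end DiagonalAction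

end HantzscheWendt

/-! ### All standard generators but one generate the group. -/

namespace HantzscheWendt

variable {n : ℕ} {Γ : Type*} [Group Γ]

/-- Standard generators come with a diagonal action of the group. -/
lemma IsStandardGenerators.exists_diagonalAction {β : Fin n → Γ} (h : IsStandardGenerators β) :
    ∃ D : DiagonalAction n Γ, (∀ i, D.sgn (β i) = signPattern i) ∧
      (∀ i j, D.tr (β i) j = 0 ∨ D.tr (β i) j = 1 / 2) ∧
      (∀ i, D.tr (β i ^ 2) = Pi.single i 1) ∧
      ∀ g, D.sgn g = 1 → g ∈ Subgroup.closure (Set.range fun i => β i ^ 2) := by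
  obtain ⟨hgen, ρ, hinj, ⟨b, hb, hβ⟩, hsq, hker⟩ := h
  have hmulρ : ∀ g g' v, ρ (g * g') v = ρ g (ρ g' v) := fun g g' v => by rw [map_mul]; rfl
  -- Diagonal linear parts pass from the generators to all of `Γ`.
  have hdiag : ∀ g : Γ, ∃ s : Fin n → ℤˣ, ∀ (v : Euc n) j,
      ρ g v j = ((s j : ℤ) : ℝ) * v j + ρ g 0 j := by
    intro g
    have hg : g ∈ Subgroup.closure (Set.range β) := hgen ▸ Subgroup.mem_top g
    induction hg using Subgroup.closure_induction with
    | mem x hx =>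
      obtain ⟨i, rfl⟩ := hx
      refine ⟨signPattern i, fun v j => ?_⟩
      rw [hβ, hβ]
      split_ifs with h
      · simp [h, signPattern_self]
      · simp [signPattern_of_ne h]
    | one => exact ⟨1, fun v j => by simp⟩
    | mul x y _ _ hx hy =>
      obtain ⟨s, hs⟩ := hx
      obtain ⟨s', hs'⟩ := hy
      refine ⟨s * s', fun v j => ?_⟩
      rw [hmulρ, hmulρ, hs, hs (ρ y 0), hs' v]
      push_cast [Pi.mul_apply, Units.val_mul]
      ring
    | inv x _ hx =>
      obtain ⟨s, hs⟩ := hx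
      refine ⟨s, fun v j => ?_⟩
      have h1 : ∀ w, ρ x (ρ x⁻¹ w) = w := fun w => by rw [← hmulρ, mul_inv_cancel, map_one]; rfl
      have h2 := hs (ρ x⁻¹ v) j
      have h3 := hs (ρ x⁻¹ 0) j
      rw [h1] at h2 h3
      rcases Int.units_eq_one_or (s j) with h | h <;> simp [h] at h2 h3 ⊢ <;> linarith
  choose s hs using hdiag
  have huniq : ∀ (g : Γ) (s' : Fin n → ℤˣ),
      (∀ (v : Euc n) j, ρ g v j = ((s' j : ℤ) : ℝ) * v j + ρ g 0 j) → s g = s' := by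
    intro g s' hs'
    funext j
    have h1 := hs g (EuclideanSpace.single j 1) j
    rw [hs'] at h1
    simpa [Units.ext_iff] using h1.symm
  have hmul : ∀ g h, s (g * h) = s g * s h := by
    intro g h
    refine huniq _ _ fun v j => ?_
    rw [hmulρ, hmulρ, hs g, hs g (ρ h 0), hs h]
    push_cast [Pi.mul_apply, Units.val_mul]
    ring
  let D : DiagonalAction n Γ :=
    { sgn := MonoidHom.mk' s hmul
      tr := fun g j => ρ g 0 j
      tr_mul := fun g h j => by
        rw [hmulρ, hs g]
        rfl
      faithful := fun g hg ht => by
        refine hinj ?_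
        rw [map_one]
        ext v j
        have hg' : s g = 1 := hg
        have h0 : ρ g 0 j = 0 := congrFun ht j
        rw [hs g, hg', h0]
        simp }
  refine ⟨D, fun i => huniq _ _ fun v j => ?_, fun i j => ?_, fun i => ?_, fun g hg => ?_⟩
  · rw [hβ, hβ]
    split_ifs with h
    · simp [h, signPattern_self]
    · simp [signPattern_of_ne h]
  · have : D.tr (β i) j = b i j := by
      change ρ (β i) 0 j = _
      rw [hβ]
      simp
    rw [this]
    exact hb i j
  · funext j
    change ρ (β i ^ 2) 0 j = _
    rw [hsq]
    simp [Pi.single_apply]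
  · rw [← hker]
    have hg' : s g = 1 := hg
    change linearPart n (ρ g) = 1
    ext v : 1
    have h1 : (linearPart n (ρ g)) v = ρ g v -ᵥ ρ g 0 := by
      have := (ρ g).map_vadd 0 v
      rw [vadd_eq_add, add_zero] at this
      rw [this, vadd_vsub]
      rfl
    rw [h1]
    ext j
    simp [hs g v, hg']

namespace DiagonalAction

variable (D : DiagonalAction n Γ)

/-- If all members of a generating family act on a coordinate by the same reflection, then the whole
group they generate fixes the centre of that reflection. -/
lemma tr_of_mem_closure {ι : Type*} (β : ι → Γ) (l : Fin n) (b : ℝ)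
    (hs : ∀ i, D.sgn (β i) l = -1) (ht : ∀ i, D.tr (β i) l = b) (g : Γ)
    (hg : g ∈ Subgroup.closure (Set.range β)) :
    D.tr g l = (1 - ((D.sgn g l : ℤ) : ℝ)) / 2 * b := by
  -- The centre is `b / 2`; a map with linear part σ fixing it has translational part (1 - σ)b/2.
  induction hg using Subgroup.closure_induction with
  | mem x hx =>
    obtain ⟨i, rfl⟩ := hx
    rw [ht, hs]
    norm_num
  | one => simp [D.tr_one]
  | mul x y _ _ hx hy =>
    rw [D.tr_mul, hx, hy]
    push_cast [map_mul, Pi.mul_apply, Units.val_mul]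
    ring
  | inv x _ hx =>
    have h1 := D.tr_mul x x⁻¹ l
    rw [mul_inv_cancel, D.tr_one, hx] at h1
    rcases Int.units_eq_one_or (D.sgn x l) with h | h <;> simp [h] at h1 ⊢ <;> linarith

/-- All standard generators but the last generate the group. -/
theorem mem_closure_of_ne (hn : 2 ≤ n) (hodd : Odd n) (hΓ : ∀ g : Γ, g ^ 2 = 1 → g = 1)
    (β : Fin n → Γ) (l : Fin n) (hs : ∀ i, D.sgn (β i) = signPattern i)
    (hb : ∀ i j, D.tr (β i) j = 0 ∨ D.tr (β i) j = 1 / 2)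
    (hsq : ∀ i, D.tr (β i ^ 2) = Pi.single i 1)
    (hker : ∀ g, D.sgn g = 1 → g ∈ Subgroup.closure (Set.range fun i => β i ^ 2)) :
    β l ∈ Subgroup.closure (Set.range fun i : {i // i ≠ l} => β i) := by
  set H := Subgroup.closure (Set.range fun i : {i // i ≠ l} => β i) with hH
  have hβH : ∀ i, i ≠ l → β i ∈ H := fun i hi => Subgroup.subset_closure ⟨⟨i, hi⟩, rfl⟩
  have hint : ∀ g, D.sgn g = 1 → ∀ j, ∃ k : ℤ, D.tr g j = k := by
    have key : ∀ g ∈ Subgroup.closure (Set.range fun i => β i ^ 2),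
        D.sgn g = 1 ∧ ∀ j, ∃ k : ℤ, D.tr g j = k := by
      intro g hg
      induction hg using Subgroup.closure_induction with
      | mem x hx =>
        obtain ⟨i, rfl⟩ := hx
        refine ⟨D.sgn_sq _, fun j => ?_⟩
        rw [hsq]
        by_cases hj : j = i
        · subst hj; exact ⟨1, by simp⟩
        · exact ⟨0, by simp [hj]⟩
      | one => exact ⟨map_one _, fun j => ⟨0, by simp [D.tr_one]⟩⟩
      | mul x y _ _ hx hy =>
        refine ⟨by rw [map_mul, hx.1, hy.1, one_mul], fun j => ?_⟩
        obtain ⟨k, hk⟩ := hx.2 j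
        obtain ⟨k', hk'⟩ := hy.2 j
        exact ⟨k + k', by rw [D.tr_mul_of_sgn_eq_one hx.1, Pi.add_apply, hk, hk', Int.cast_add]⟩
      | inv x _ hx =>
        refine ⟨by rw [map_inv, hx.1, inv_one], fun j => ?_⟩
        obtain ⟨k, hk⟩ := hx.2 j
        exact ⟨-k, by rw [D.tr_inv_of_sgn_eq_one hx.1, Pi.neg_apply, hk, Int.cast_neg]⟩
    exact fun g hg => (key g (hker g hg)).2
  obtain ⟨γ, hγH, hγ⟩ : signPattern l ∈ H.map D.sgn := by
    refine mem_of_signPattern_mem _ _ (prod_signPattern hodd l) fun i hi => ?_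
    have hil : i ≠ l := by
      rintro rfl
      rw [signPattern_self] at hi
      exact absurd hi (by decide)
    exact ⟨β i, hβH i hil, hs i⟩
  -- Otherwise all of `H` fixes one point of the `l`-th axis, so `γ`, with sign 1 there, has no
  -- translation along it.
  have hneq : ∃ i k, i ≠ l ∧ k ≠ l ∧ D.tr (β i) l = 1 / 2 ∧ D.tr (β k) l = 0 := by
    by_contra hcon
    push Not at hcon
    have : ∃ b, ∀ i : {i // i ≠ l}, D.tr (β i) l = b := by
      by_cases h0 : ∀ i, i ≠ l → D.tr (β i) l = 0
      · exact ⟨0, fun i => h0 i i.2⟩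
      · push Not at h0
        obtain ⟨i, hi, hi0⟩ := h0
        exact ⟨1 / 2, fun k => (hb k l).resolve_left
          (hcon i k hi k.2 ((hb i l).resolve_left hi0))⟩
    obtain ⟨b, hb'⟩ := this
    refine D.tr_ne_zero_of_signPattern hn hΓ hγ ?_
    rw [D.tr_of_mem_closure (fun i : {i // i ≠ l} => β i) l b
      (fun i => by rw [hs, signPattern_of_ne i.2.symm]) hb' γ hγH, hγ, signPattern_self]
    simp
  obtain ⟨i, k, hi, hk, hbi, hbk⟩ := hneq
  have hsingle : ∀ j, Pi.single j (1 : ℝ) ∈ D.translations H := by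
    have hne : ∀ j, j ≠ l → Pi.single j (1 : ℝ) ∈ D.translations H := fun j hj =>
      ⟨β j ^ 2, Subgroup.pow_mem _ (hβH j hj) 2, D.sgn_sq _, hsq j⟩
    intro j
    by_cases hj : j = l
    swap
    · exact hne j hj
    subst hj
    set h := (β i * β k) ^ 2 with hh
    have hhs : D.sgn h = 1 := D.sgn_sq _
    have hhH : D.tr h ∈ D.translations H :=
      ⟨h, Subgroup.pow_mem _ (mul_mem (hβH i hi) (hβH k hk)) 2, hhs, rfl⟩
    have hhj : D.tr h j = 1 := by
      rw [hh, D.tr_sq_of_one, D.tr_mul, hbi, hbk]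
      · norm_num
      · simp [hs, signPattern_of_ne hi.symm, signPattern_of_ne hk.symm]
    choose z hz using hint h hhs
    -- The other coordinates of `h` are integers and are cleared by squares of generators in `H`.
    have : Pi.single j (1 : ℝ) = D.tr h -
        ∑ m ∈ Finset.univ.erase j, z m • Pi.single (M := fun _ => ℝ) m (1 : ℝ) := by
      funext m
      by_cases hm : m = j
      · subst hm
        simp [Finset.sum_apply, Pi.single_apply, hhj]
      · simp [Finset.sum_apply, Pi.single_apply, hm, hz]
    rw [this]
    refine AddSubgroup.sub_mem _ hhH (AddSubgroup.sum_mem _ fun m hm => ?_)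
    exact AddSubgroup.zsmul_mem _ (hne m (Finset.ne_of_mem_erase hm)) _
  have hmem : γ * (β l)⁻¹ ∈ H := by
    have h1 : D.sgn (γ * (β l)⁻¹) = 1 := by rw [map_mul, map_inv, hγ, hs, mul_inv_cancel]
    exact D.mem_of_tr_mem h1 (mem_of_single_mem _ hsingle _ (hint _ h1))
  have := (Subgroup.mul_mem_cancel_left _ hγH).1 hmem
  simpa using this

end DiagonalAction

end HantzscheWendt

/-! ### The group `CHW`, its squares, and freeness of the kernel. -/

namespace HantzscheWendt

open scoped IsMulCommutative in
/-- A homomorphism from a commutative group that maps generators to independent elements is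
injective. -/
lemma eq_one_of_linearIndependent {ι A V : Type*} [Fintype ι] [Group A] [IsMulCommutative A]
    [AddCommGroup V] (y : ι → A) (hy : Subgroup.closure (Set.range y) = ⊤) {v : ι → V}
    (hv : LinearIndependent ℤ v) (f : A →* Multiplicative V)
    (hf : ∀ i, f (y i) = Multiplicative.ofAdd (v i)) (a : A) (ha : f a = 1) : a = 1 := by
  obtain ⟨z, hz⟩ : ∃ z : ι → ℤ, a = ∏ i, y i ^ z i := by
    obtain ⟨z, hz⟩ := Subgroup.exists_finsupp_of_mem_closure_range y a (hy ▸ Subgroup.mem_top a)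
    exact ⟨z, by rw [hz, Finsupp.prod_fintype]; simp⟩
  have h0 : ∑ i, z i • v i = 0 := by
    rw [hz, map_prod] at ha
    simpa [hf, ← ofAdd_zsmul, ← ofAdd_sum] using ha
  have hz0 := Fintype.linearIndependent_iff.1 hv z h0
  rw [hz]
  exact Finset.prod_eq_one fun i _ => by rw [hz0 i, zpow_zero]

namespace CHW

variable {m : ℕ}

lemma relation {i j : Fin m} (h : i ≠ j) :
    (x i : CHW m)⁻¹ * x j ^ 2 * x i = (x j ^ 2)⁻¹ := by
  have h1 : (PresentedGroup.mk (chwRelators m))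
      ((FreeGroup.of i)⁻¹ * FreeGroup.of j ^ 2 * FreeGroup.of i * FreeGroup.of j ^ 2) = 1 :=
    PresentedGroup.one_of_mem ⟨i, j, h, rfl⟩
  simp only [map_mul, map_inv, map_pow] at h1
  exact eq_inv_of_mul_eq_one_left h1

/-- Conjugation by `x i` inverts `x j ^ 2`, so doing it twice is trivial. -/
lemma commute_sq (i j : Fin m) : Commute ((x i : CHW m) ^ 2) (x j ^ 2) := by
  by_cases h : i = j
  · subst h; exact Commute.refl _
  have h1 := relation h
  have h2 : (x i : CHW m)⁻¹ * (x j ^ 2)⁻¹ * x i = x j ^ 2 := by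
    have := congrArg Inv.inv h1
    simpa [mul_assoc] using this
  have h3 : (x i ^ 2 : CHW m)⁻¹ * x j ^ 2 * x i ^ 2 = x j ^ 2 := by
    calc (x i ^ 2 : CHW m)⁻¹ * x j ^ 2 * x i ^ 2
        = (x i)⁻¹ * ((x i)⁻¹ * x j ^ 2 * x i) * x i := by
          simp only [pow_two, mul_inv_rev, mul_assoc]
      _ = x j ^ 2 := by rw [h1, h2]
  rw [mul_assoc, inv_mul_eq_iff_eq_mul] at h3
  exact h3.symm

/-- The subgroup generated by the squares of the generators. -/
def squares (m : ℕ) : Subgroup (CHW m) := Subgroup.closure (Set.range fun i => x i ^ 2)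

lemma sq_mem_squares (i : Fin m) : (x i : CHW m) ^ 2 ∈ squares m := Subgroup.subset_closure ⟨i, rfl⟩

lemma closure_range_x : Subgroup.closure (Set.range (x : Fin m → CHW m)) = ⊤ :=
  PresentedGroup.closure_range_of _

lemma conj_sq_mem (i j : Fin m) : (x i : CHW m)⁻¹ * x j ^ 2 * x i ∈ squares m := by
  by_cases h : i = j
  · subst h
    rw [show (x i : CHW m)⁻¹ * x i ^ 2 * x i = x i ^ 2 by group]
    exact sq_mem_squares i
  · rw [relation h]
    exact inv_mem (sq_mem_squares j)

lemma conj_sq_mem' (i j : Fin m) : (x i : CHW m) * x j ^ 2 * (x i)⁻¹ ∈ squares m := by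
  have h : (x i : CHW m) * x j ^ 2 * (x i)⁻¹ =
      x i ^ 2 * ((x i)⁻¹ * x j ^ 2 * x i) * (x i ^ 2)⁻¹ := by group
  rw [h]
  exact mul_mem (mul_mem (sq_mem_squares i) (conj_sq_mem i j)) (inv_mem (sq_mem_squares i))

instance squares_normal : (squares m).Normal := by
  have h1 : ∀ (i : Fin m) (a : CHW m), a ∈ squares m → x i * a * (x i)⁻¹ ∈ squares m := by
    intro i a ha
    have : squares m ≤ (squares m).comap (MulAut.conj (x i : CHW m)).toMonoidHom := by
      refine (Subgroup.closure_le _).2 ?_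
      rintro _ ⟨j, rfl⟩
      exact conj_sq_mem' i j
    exact this ha
  have h2 : ∀ (i : Fin m) (a : CHW m), a ∈ squares m → (x i)⁻¹ * a * x i ∈ squares m := by
    intro i a ha
    have : squares m ≤ (squares m).comap (MulAut.conj (x i : CHW m)⁻¹).toMonoidHom := by
      refine (Subgroup.closure_le _).2 ?_
      rintro _ ⟨j, rfl⟩
      simpa using conj_sq_mem i j
    simpa using this ha
  rw [← Subgroup.normalizer_eq_top_iff, eq_top_iff, ← closure_range_x, Subgroup.closure_le]
  rintro _ ⟨i, rfl⟩
  refine Subgroup.mem_normalizer_iff.2 fun a => ⟨h1 i a, fun ha => ?_⟩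
  have := h2 i _ ha
  rwa [show (x i : CHW m)⁻¹ * (x i * a * (x i)⁻¹) * x i = a by group] at this

lemma eq_one_of_mem_squares {V : Type*} [AddCommGroup V] {v : Fin m → V}
    (hv : LinearIndependent ℤ v) (f : squares m →* Multiplicative V)
    (hf : ∀ i, f ⟨x i ^ 2, sq_mem_squares i⟩ = Multiplicative.ofAdd (v i))
    (a : squares m) (ha : f a = 1) : a = 1 := by
  have : IsMulCommutative (squares m) := Subgroup.isMulCommutative_closure (by
    rintro _ ⟨i, rfl⟩ _ ⟨j, rfl⟩
    exact commute_sq i j)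
  refine eq_one_of_linearIndependent (fun i => ⟨x i ^ 2, sq_mem_squares i⟩) ?_ hv f hf a ha
  refine Eq.trans ?_ (Subgroup.closure_closure_coe_preimage
    (k := Set.range fun i : Fin m => (x i : CHW m) ^ 2))
  exact congrArg Subgroup.closure (Set.ext fun y =>
    exists_congr fun i => (Subtype.ext_iff : _ ↔ (x i ^ 2 : CHW m) = y))

/-- The automorphism of a free group that inverts the generators. -/
noncomputable def invGens (α : Type*) : MulAut (FreeGroup α) :=
  MulEquiv.ofBijective (FreeGroup.lift fun i => (FreeGroup.of i)⁻¹)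
    (Function.Involutive.bijective fun w => by
      have : ((FreeGroup.lift fun i : α => (FreeGroup.of i)⁻¹).comp
          (FreeGroup.lift fun i : α => (FreeGroup.of i)⁻¹)) = MonoidHom.id _ := by
        ext i; simp
      exact DFunLike.congr_fun this w)

lemma invGens_of {α : Type*} (i : α) : invGens α (FreeGroup.of i) = (FreeGroup.of i)⁻¹ := by
  simp [invGens]

lemma invGens_mul_self (α : Type*) : invGens α * invGens α = 1 := by
  have : (invGens α * invGens α).toMonoidHom = MonoidHom.id _ := by
    ext i; simp [invGens_of]
  ext w
  exact DFunLike.congr_fun this w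

/-- The action of `±1` on a free group by inverting the generators. -/
noncomputable def signAction (α : Type*) : ℤˣ →* MulAut (FreeGroup α) :=
  MonoidHom.mk' (fun u => if u = 1 then 1 else invGens α) fun u v => by
    rcases Int.units_eq_one_or u with rfl | rfl <;> rcases Int.units_eq_one_or v with rfl | rfl <;>
      simp [invGens_mul_self]

lemma signAction_neg_one (α : Type*) : signAction α (-1) = invGens α := by
  simp [signAction]

/-- The homomorphism `x i ↦ y i * t`, where `y i` are free generators inverted by the
involution `t`. -/
noncomputable def toSemidirect (m : ℕ) :
    CHW m →* FreeGroup (Fin m) ⋊[signAction (Fin m)] ℤˣ :=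
  PresentedGroup.toGroup (f := fun i => ⟨FreeGroup.of i, -1⟩) (by
    have hsq : ∀ i : Fin m, (⟨FreeGroup.of i, -1⟩ :
        FreeGroup (Fin m) ⋊[signAction (Fin m)] ℤˣ) ^ 2 = 1 := by
      intro i
      rw [pow_two]
      ext
      · simp [signAction_neg_one, invGens_of]
      · simp
    rintro _ ⟨i, j, -, rfl⟩
    simp only [map_mul, map_inv, map_pow, FreeGroup.lift_apply_of, hsq]
    group)

lemma toSemidirect_x (i : Fin m) : toSemidirect m (x i) = ⟨FreeGroup.of i, -1⟩ :=
  PresentedGroup.toGroup.of _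

/-- The retraction of the semidirect product that kills the involution. -/
noncomputable def fromSemidirect (m : ℕ) :
    FreeGroup (Fin m) ⋊[signAction (Fin m)] ℤˣ →* CHW m ⧸ squares m :=
  SemidirectProduct.lift (FreeGroup.lift fun i => (QuotientGroup.mk (x i) : CHW m ⧸ squares m)) 1
    fun u => by
      ext i
      have h : ((QuotientGroup.mk (x i) : CHW m ⧸ squares m))⁻¹ = QuotientGroup.mk (x i) := by
        rw [inv_eq_iff_mul_eq_one, ← pow_two, ← QuotientGroup.mk_pow, QuotientGroup.eq_one_iff]
        exact sq_mem_squares i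
      rcases Int.units_eq_one_or u with rfl | rfl
      · simp
      · simp [signAction_neg_one, invGens_of, h]

/-- The projection onto the quotient by the squares factors through `toSemidirect`, via
`fromSemidirect`. -/
lemma mem_squares_of_toSemidirect_eq_one (g : CHW m) (hg : toSemidirect m g = 1) :
    g ∈ squares m := by
  have : (fromSemidirect m).comp (toSemidirect m) = QuotientGroup.mk' (squares m) := by
    refine PresentedGroup.ext fun i => ?_
    change fromSemidirect m (toSemidirect m (x i)) = _
    rw [toSemidirect_x, fromSemidirect, SemidirectProduct.mk_eq_inl_mul_inr, map_mul,
      SemidirectProduct.lift_inl, SemidirectProduct.lift_inr]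
    simp
    rfl
  rw [← QuotientGroup.eq_one_iff]
  have h := DFunLike.congr_fun this g
  rw [MonoidHom.comp_apply, hg, map_one] at h
  exact h.symm

/-- A subgroup that meets the squares trivially and consists of words of even length is free. -/
theorem isFreeGroup_of_disjoint_squares (K : Subgroup (CHW m))
    (hA : ∀ k ∈ K, k ∈ squares m → k = 1)
    (hpar : ∀ k ∈ K, (toSemidirect m k).right = 1) : IsFreeGroup K := by
  let f : K →* FreeGroup (Fin m) := MonoidHom.mk' (fun k => (toSemidirect m k).left) fun a b => by
    simp [hpar a a.2]
  have hf : Function.Injective f := by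
    refine (injective_iff_map_eq_one _).2 fun k hk => Subtype.ext (hA k k.2 ?_)
    exact mem_squares_of_toSemidirect_eq_one _ (SemidirectProduct.ext hk (hpar k k.2))
  exact IsFreeGroup.ofMulEquiv (MonoidHom.ofInjective hf).symm

end CHW

variable {n : ℕ} {Γ : Type*} [Group Γ]

namespace DiagonalAction

variable (D : DiagonalAction n Γ)

/-- The relations of `CHW` hold among elements whose linear parts are distinct sign patterns. -/
lemma relation_of_signPattern (β : Fin n → Γ) (hs : ∀ i, D.sgn (β i) = signPattern i)
    (hsq : ∀ i, D.tr (β i ^ 2) = Pi.single i 1) {i j : Fin n} (h : i ≠ j) :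
    (β i)⁻¹ * β j ^ 2 * β i * β j ^ 2 = 1 := by
  rw [mul_assoc, mul_assoc, inv_mul_eq_one, eq_comm]
  refine D.ext_of_eq (by rw [map_mul, map_mul, D.sgn_sq, one_mul, mul_one]) ?_
  rw [D.tr_mul_of_sgn_eq_one (D.sgn_sq _)]
  funext l
  rw [Pi.add_apply, D.tr_mul, hs, hsq]
  by_cases hl : l = j
  · subst hl
    simp [signPattern_of_ne h.symm]
  · simp [hl]

/-- The homomorphism from `CHW` onto the subgroup generated by the first `n - 1` standard
generators, and the freeness of its kernel. -/
theorem exists_hom_isFreeGroup_ker (hn : 2 ≤ n) (β : Fin n → Γ)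
    (hs : ∀ i, D.sgn (β i) = signPattern i)
    (hsq : ∀ i, D.tr (β i ^ 2) = Pi.single i 1) :
    ∃ Φ : CHW (n - 1) →* Γ,
      (∀ i : Fin (n - 1), Φ (CHW.x i) = β (Fin.castLE (Nat.sub_le n 1) i)) ∧
      IsFreeGroup Φ.ker := by
  set ι : Fin (n - 1) → Fin n := Fin.castLE (Nat.sub_le n 1) with hι
  have hιinj : Function.Injective ι := Fin.castLE_injective _
  let Φ : CHW (n - 1) →* Γ := PresentedGroup.toGroup (f := fun i => β (ι i)) (by
    rintro _ ⟨i, j, hij, rfl⟩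
    simpa using D.relation_of_signPattern β hs hsq (hιinj.ne hij))
  have hΦ : ∀ i, Φ (CHW.x i) = β (ι i) := fun i => PresentedGroup.toGroup.of _
  refine ⟨Φ, hΦ, CHW.isFreeGroup_of_disjoint_squares _ (fun k hk hkA => ?_) fun k hk => ?_⟩
  · have hle : CHW.squares (n - 1) ≤ (D.sgn.comp Φ).ker := by
      refine (Subgroup.closure_le _).2 ?_
      rintro _ ⟨i, rfl⟩
      change D.sgn (Φ (CHW.x i ^ 2)) = 1
      rw [map_pow, D.sgn_sq]
    let f : CHW.squares (n - 1) →* Multiplicative (Fin n → ℝ) :=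
      MonoidHom.mk' (fun a => Multiplicative.ofAdd (D.tr (Φ a))) fun a b => by
        rw [Subgroup.coe_mul, map_mul, D.tr_mul_of_sgn_eq_one (hle a.2), ofAdd_add]
    have hv : LinearIndependent ℤ fun i : Fin (n - 1) => Pi.single (M := fun _ => ℝ) (ι i) (1 : ℝ) := by
      rw [Fintype.linearIndependent_iff]
      intro z hz i
      have := congrFun hz (ι i)
      simpa [Finset.sum_apply, Pi.single_apply, hιinj.eq_iff] using this
    have := CHW.eq_one_of_mem_squares hv f (fun i => by
      change Multiplicative.ofAdd (D.tr (Φ (CHW.x i ^ 2))) = _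
      rw [map_pow, hΦ, hsq]) ⟨k, hkA⟩ (by
      change Multiplicative.ofAdd (D.tr (Φ k)) = 1
      rw [MonoidHom.mem_ker.1 hk, D.tr_one]
      rfl)
    exact congrArg Subtype.val this
  · let l : Fin n := ⟨n - 1, by omega⟩
    -- The index `l` is missed by `ι`, so every generator has sign -1 there: this sign is the parity
    -- of word length.
    have heq : SemidirectProduct.rightHom.comp (CHW.toSemidirect (n - 1)) =
        ((Pi.evalMonoidHom _ l).comp D.sgn).comp Φ := by
      refine PresentedGroup.ext fun i => ?_
      change (CHW.toSemidirect (n - 1) (CHW.x i)).right = D.sgn (Φ (CHW.x i)) l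
      rw [CHW.toSemidirect_x, hΦ, hs, signPattern_of_ne]
      intro h
      have := congrArg Fin.val h
      simp [l, hι] at this
      omega
    have := DFunLike.congr_fun heq k
    simp only [MonoidHom.comp_apply, MonoidHom.mem_ker.1 hk, map_one] at this
    exact this

end DiagonalAction

end HantzscheWendt

/-! ### From flat manifolds to diagonal actions. -/

namespace HantzscheWendt

variable {n : ℕ}

open scoped Function in
/-- Commuting orthogonal involutions have a basis of common eigenvectors. -/
lemma exists_basis_eigenvectors (H : Subgroup (Euc n ≃ₗᵢ[ℝ] Euc n))
    (hcomm : ∀ g h : H, g * h = h * g) (hsq : ∀ g : H, g * g = 1) :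
    ∃ u : Module.Basis (Fin n) ℝ (Euc n), ∃ s : H →* (Fin n → ℤˣ),
      ∀ (h : H) j, (h : Euc n ≃ₗᵢ[ℝ] Euc n) (u j) = ((s h j : ℤ) : ℝ) • u j := by
  have hinv : ∀ (h : H) v, (h : Euc n ≃ₗᵢ[ℝ] Euc n) ((h : Euc n ≃ₗᵢ[ℝ] Euc n) v) = v := by
    intro h v
    have := congrArg (fun g : H => (g : Euc n ≃ₗᵢ[ℝ] Euc n) v) (hsq h)
    exact this
  let T : H → (Euc n →ₗ[ℝ] Euc n) := fun h => (h : Euc n ≃ₗᵢ[ℝ] Euc n).toLinearEquiv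
  have hT : ∀ h, (T h).IsSymmetric := by
    intro h v w
    change inner ℝ ((h : Euc n ≃ₗᵢ[ℝ] Euc n) v) w = inner ℝ v ((h : Euc n ≃ₗᵢ[ℝ] Euc n) w)
    -- An orthogonal involution is its own adjoint.
    rw [← (h : Euc n ≃ₗᵢ[ℝ] Euc n).inner_map_map v, hinv]
  have hC : Pairwise (Commute on T) := by
    intro g h _
    ext1 v
    exact congrArg (fun k : H => (k : Euc n ≃ₗᵢ[ℝ] Euc n) v) (hcomm g h)
  have htop := LinearMap.IsSymmetric.iSup_iInf_eq_top_of_commute hT hC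
  let S : Set (Euc n) := {v | ∃ χ : H → ℝ, ∀ h, T h v = χ h • v}
  have hS : ⊤ ≤ Submodule.span ℝ S := by
    rw [← htop]
    refine iSup_le fun χ v hv => Submodule.subset_span ⟨χ, fun h => ?_⟩
    exact Module.End.mem_eigenspace_iff.1 ((Submodule.mem_iInf _).1 hv h)
  let u₀ := Module.Basis.ofSpan hS
  have hu₀ : ∀ k, u₀ k ∈ S := fun k => Module.Basis.ofSpan_subset hS ⟨k, rfl⟩
  have : Fintype _ := FiniteDimensional.fintypeBasisIndex u₀
  have hcard := Module.finrank_eq_card_basis u₀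
  rw [finrank_euclideanSpace, Fintype.card_fin] at hcard
  let u := u₀.reindex (Fintype.equivFinOfCardEq hcard.symm)
  have hu : ∀ j, ∃ χ : H → ℝ, ∀ h, T h (u j) = χ h • u j := fun j => by
    rw [Module.Basis.reindex_apply]
    exact hu₀ _
  choose χ hχ using hu
  have hsign : ∀ (h : H) j, ∃ e : ℤˣ, χ j h = ((e : ℤ) : ℝ) := by
    intro h j
    have h1 : χ j h * χ j h = 1 := by
      have h2 := hinv h (u j)
      change T h (T h (u j)) = u j at h2
      rw [hχ, map_smul, hχ, smul_smul] at h2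
      refine smul_left_injective ℝ (u.ne_zero j) ?_
      simpa using h2
    rcases mul_self_eq_one_iff.1 h1 with h3 | h3
    · exact ⟨1, by simp [h3]⟩
    · exact ⟨-1, by simp [h3]⟩
  choose s hs using hsign
  refine ⟨u, MonoidHom.mk' s fun g h => ?_, fun h j => ?_⟩
  · funext j
    have h1 : T (g * h) (u j) = T g (T h (u j)) := rfl
    rw [hχ, hχ, map_smul, hχ, smul_smul, hs, hs, hs] at h1
    have h2 := smul_left_injective ℝ (u.ne_zero j) h1
    rw [Units.ext_iff, Pi.mul_apply, Units.val_mul, mul_comm]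
    exact_mod_cast h2
  · rw [MonoidHom.mk'_apply, ← hs]
    exact hχ j h

lemma card_prod_eq_one (hn : 1 ≤ n) :
    Nat.card (∏ i : Fin n, Pi.evalMonoidHom (fun _ => ℤˣ) i : (Fin n → ℤˣ) →* ℤˣ).ker =
      2 ^ (n - 1) := by
  set π : (Fin n → ℤˣ) →* ℤˣ := ∏ i : Fin n, Pi.evalMonoidHom (fun _ => ℤˣ) i with hπ
  have hsurj : Function.Surjective π := by
    intro e
    refine ⟨Pi.mulSingle ⟨0, hn⟩ e, ?_⟩
    simp [hπ, MonoidHom.finsetProd_apply]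
  have h := π.ker.card_mul_index
  rw [Subgroup.index_ker, MonoidHom.range_eq_top.2 hsurj, Subgroup.card_top] at h
  simp only [Nat.card_eq_fintype_card, Fintype.card_pi, Fintype.card_units_int, Finset.prod_const,
    Finset.card_univ, Fintype.card_fin] at h ⊢
  obtain ⟨k, rfl⟩ : ∃ k, n = k + 1 := ⟨n - 1, by omega⟩
  rw [pow_succ] at h
  simpa using h

/-- A discrete subgroup of the reals is cyclic. -/
lemma exists_eq_mul_of_finite (S : AddSubgroup ℝ) (hS : ((S : Set ℝ) ∩ Set.Ioo 0 1).Finite) :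
    ∃ c : ℝ, ∀ x, x ∈ S ↔ ∃ k : ℤ, x = k * c := by
  rcases S.dense_or_cyclic with h | ⟨c, rfl⟩
  · exfalso
    have h1 := h.open_subset_closure_inter (isOpen_Ioo (a := (0 : ℝ)) (b := 1))
    rw [Set.inter_comm, hS.isClosed.closure_eq] at h1
    exact (Set.Ioo_infinite (zero_lt_one' ℝ)) (hS.subset h1)
  · refine ⟨c, fun x => ?_⟩
    rw [AddSubgroup.mem_closure_singleton]
    simp [eq_comm]

namespace FlatManifold

variable (M : FlatManifold n)

lemma apply_eq (g : Isom n) (v : Euc n) : g v = linearPart n g v + g 0 := by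
  have := g.map_vadd 0 v
  rwa [vadd_eq_add, add_zero] at this

lemma eq_one_of_sq_eq_one (g : M.deck) (hg : g ^ 2 = 1) : g = 1 := by
  refine Subtype.ext (M.free g g.2 (midpoint ℝ 0 ((g : Isom n) 0)) ?_)
  have h2 : (g : Isom n) ((g : Isom n) 0) = 0 := by
    have := congrArg (fun k : M.deck => (k : Isom n) 0) hg
    simpa [pow_two] using this
  have h3 := (g : Isom n).toAffineEquiv.toAffineMap.map_midpoint 0 ((g : Isom n) 0)
  refine h3.trans ?_
  change midpoint ℝ ((g : Isom n) 0) ((g : Isom n) ((g : Isom n) 0)) = _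
  rw [h2, midpoint_comm]

/-- The group of deck transformations is isomorphic to the fundamental group. -/
lemma nonempty_fundamentalGroup_equiv (p : M.Carrier) :
    Nonempty (FundamentalGroup M.Carrier p ≃* M.deck) := by
  have hpd := M.properlyDiscontinuous
  have : ContinuousConstSMul M.deck (Euc n) := ⟨fun g => (g : Isom n).continuous⟩
  have : IsCancelSMul M.deck (Euc n) := isCancelSMul_iff_eq_one_of_smul_eq.2 fun g v h =>
    Subtype.ext (M.free g g.2 v h)
  have hq : IsQuotientCoveringMap (Quotient.mk (MulAction.orbitRel M.deck (Euc n))) M.deck :=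
    isQuotientCoveringMap_quotientMk_of_properlyDiscontinuousSMul
  obtain ⟨e, he⟩ := hq.surjective p
  -- Covering theory yields the opposite of the deck group; inversion turns it around.
  exact ⟨(hq.fundamentalGroupEquiv ⟨e, he⟩).trans (MulEquiv.inv' M.deck).symm⟩

/-- The deck group of an orientable flat manifold with holonomy `(ℤ/2)ⁿ⁻¹` acts diagonally in
suitable coordinates. -/
theorem exists_diagonalAction (hn : 2 ≤ n) (hor : M.Orientable)
    (hhol : Nonempty (M.holonomy ≃* Multiplicative (Fin (n - 1) → ZMod 2))) :
    ∃ D : DiagonalAction n M.deck, (∀ g, ∏ j, D.sgn g j = 1) ∧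
      (∀ s : Fin n → ℤˣ, ∏ j, s j = 1 → ∃ g, D.sgn g = s) ∧
      ∀ i, ∃ c : ℝ, ∀ x : ℝ, Pi.single i x ∈ D.translations ⊤ ↔ ∃ k : ℤ, x = k * c := by
  obtain ⟨e⟩ := hhol
  have hcomm : ∀ g h : M.holonomy, g * h = h * g := fun g h => e.injective (by
    rw [map_mul, map_mul, mul_comm])
  have hsq : ∀ g : M.holonomy, g * g = 1 := fun g => e.injective (by
    rw [map_mul, map_one]
    exact congrArg Multiplicative.ofAdd (funext fun i => CharTwo.add_self_eq_zero _))
  obtain ⟨u, s, hu⟩ := exists_basis_eigenvectors M.holonomy hcomm hsq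
  have hrepr : ∀ (h : M.holonomy) v j,
      u.repr ((h : Euc n ≃ₗᵢ[ℝ] Euc n) v) j = ((s h j : ℤ) : ℝ) * u.repr v j := by
    intro h v j
    conv_lhs => rw [← u.sum_repr v, map_sum, map_sum, Finsupp.finsetSum_apply]
    simp [hu, Finsupp.single_apply, mul_comm]
  have hsinj : Function.Injective s := by
    refine (injective_iff_map_eq_one _).2 fun h hh => Subtype.ext ?_
    ext1 v
    refine u.repr.injective (Finsupp.ext fun j => ?_)
    rw [hrepr, hh]
    simp
  let lin : M.deck →* M.holonomy :=
    ((linearPart n).comp M.deck.subtype).codRestrict M.holonomy fun g => ⟨g, g.2, rfl⟩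
  have hlin : ∀ h : M.holonomy, ∃ g, lin g = h := by
    rintro ⟨_, g, hg, rfl⟩
    exact ⟨⟨g, hg⟩, rfl⟩
  have happ : ∀ (g : M.deck) v j, u.repr ((g : Isom n) v) j =
      ((s (lin g) j : ℤ) : ℝ) * u.repr v j + u.repr ((g : Isom n) 0) j := by
    intro g v j
    rw [apply_eq, map_add, Finsupp.add_apply]
    exact congrArg (· + _) (hrepr (lin g) v j)
  let D : DiagonalAction n M.deck :=
    { sgn := s.comp lin
      tr := fun g j => u.repr ((g : Isom n) 0) j
      tr_mul := fun g h j => happ g ((h : Isom n) 0) j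
      faithful := fun g hs ht => Subtype.ext (by
        ext1 v
        refine u.repr.injective (Finsupp.ext fun j => ?_)
        have h0 : u.repr ((g : Isom n) 0) j = 0 := congrFun ht j
        have h1 : s (lin g) = 1 := hs
        rw [happ, h0, h1]
        simp) }
  have hprod : ∀ h : M.holonomy, ∏ j, s h j = 1 := by
    intro h
    obtain ⟨g, rfl⟩ := hlin h
    have hpos := hor g g.2
    rw [← LinearMap.det_toMatrix u] at hpos
    have hdiag : LinearMap.toMatrix u u ((linearPart n (g : Isom n)).toLinearEquiv :
        Euc n →ₗ[ℝ] Euc n) = Matrix.diagonal fun j => ((s (lin g) j : ℤ) : ℝ) := by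
      ext i j
      rw [LinearMap.toMatrix_apply]
      have h1 := hrepr (lin g) (u j) i
      refine h1.trans ?_
      rw [u.repr_self, Finsupp.single_apply, Matrix.diagonal_apply]
      by_cases hij : i = j
      · simp [hij]
      · simp [hij, Ne.symm hij]
    rw [hdiag, Matrix.det_diagonal] at hpos
    rcases Int.units_eq_one_or (∏ j, s (lin g) j) with h | h
    · exact h
    · have h2 := congrArg (fun w : ℤˣ => ((w : ℤ) : ℝ)) h
      simp only [Units.coe_prod, Int.cast_prod] at h2
      rw [h2] at hpos
      norm_num at hpos
  refine ⟨D, fun g => hprod _, fun σ hσ => ?_, fun i => ?_⟩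
  · set π : (Fin n → ℤˣ) →* ℤˣ := ∏ i : Fin n, Pi.evalMonoidHom (fun _ => ℤˣ) i with hπ
    have hπ' : ∀ σ, π σ = ∏ j, σ j := fun σ => by simp [hπ, MonoidHom.finsetProd_apply]
    have hle : s.range ≤ π.ker := by
      rintro _ ⟨h, rfl⟩
      exact (hπ' _).trans (hprod h)
    have hcard : Nat.card s.range = 2 ^ (n - 1) := by
      rw [← Nat.card_congr (MonoidHom.ofInjective hsinj).toEquiv, Nat.card_congr e.toEquiv,
        Nat.card_congr Multiplicative.toAdd]
      simp
    -- Both groups have order `2 ^ (n - 1)`, so every sign vector of product 1 occurs.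
    have heq := Subgroup.eq_of_le_of_card_ge hle
      (by rw [hcard, card_prod_eq_one (by omega : 1 ≤ n)])
    have hmem : σ ∈ s.range := by
      rw [heq]
      exact (hπ' _).trans hσ
    obtain ⟨h, rfl⟩ := hmem
    obtain ⟨g, rfl⟩ := hlin h
    exact ⟨g, rfl⟩
  · refine exists_eq_mul_of_finite
      ((D.translations ⊤).comap (AddMonoidHom.single (fun _ : Fin n => ℝ) i)) ?_
    have hpd := M.properlyDiscontinuous
    -- A translation by `x • u i` with 0 < x < 1 moves the origin within this ball, so only finitely
    -- many occur.
    have hfin := hpd.finite_disjoint_inter_image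
      (isCompact_closedBall (0 : Euc n) ‖u i‖) (isCompact_closedBall (0 : Euc n) ‖u i‖)
    refine (hfin.image fun g => D.tr g i).subset ?_
    rintro x ⟨⟨g, -, hs, hx⟩, hx0, hx1⟩
    refine ⟨g, ?_, (congrFun hx i).trans (by simp)⟩
    have hg0 : (g : Isom n) 0 = x • u i := by
      refine u.repr.injective (Finsupp.ext fun j => ?_)
      refine (congrFun hx j).trans ?_
      simp [Pi.single_apply, Finsupp.single_apply, eq_comm]
    refine ⟨x • u i, ⟨0, by simp, hg0⟩, ?_⟩
    rw [mem_closedBall_zero_iff, norm_smul, Real.norm_of_nonneg hx0.le]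
    exact mul_le_of_le_one_left (norm_nonneg _) hx1.le

end FlatManifold

/-- Pull back a diagonal action along an isomorphism of groups. -/
def DiagonalAction.comap {Γ Δ : Type*} [Group Γ] [Group Δ] (D : DiagonalAction n Δ)
    (e : Γ ≃* Δ) : DiagonalAction n Γ where
  sgn := D.sgn.comp e.toMonoidHom
  tr g := D.tr (e g)
  tr_mul g h j := by rw [map_mul, D.tr_mul]; rfl
  faithful g hs ht := e.injective (by rw [map_one]; exact D.faithful _ hs ht)

end HantzscheWendt

/-! ### Assembly of the theorem. -/

theorem theorem3p5 (n : ℕ) (hn : 2 ≤ n) (Γ : Type*) [Group Γ]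
    (hΓ : HantzscheWendt.IsHWGroup n Γ) :
    (∃ β : Fin n → Γ, HantzscheWendt.IsStandardGenerators β) ∧
    ∀ β : Fin n → Γ, HantzscheWendt.IsStandardGenerators β →
      ∃ Φ : HantzscheWendt.CHW (n - 1) →* Γ,
        (∀ i : Fin (n - 1),
          Φ (HantzscheWendt.CHW.x i) = β (Fin.castLE (Nat.sub_le n 1) i)) ∧
        Function.Surjective Φ ∧
        IsFreeGroup Φ.ker := by
  obtain ⟨M, hor, hhol, p, ⟨e₁⟩⟩ := hΓ
  obtain ⟨e₂⟩ := M.nonempty_fundamentalGroup_equiv p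
  let e : Γ ≃* M.deck := e₁.trans e₂
  have htor : ∀ g : Γ, g ^ 2 = 1 → g = 1 := fun g hg => e.injective (by
    rw [map_one]
    exact M.eq_one_of_sq_eq_one _ (by rw [← map_pow, hg, map_one]))
  obtain ⟨D, hprod, hsurj, hdisc⟩ := M.exists_diagonalAction hn hor hhol
  have hsurj' : ∀ s : Fin n → ℤˣ, ∏ j, s j = 1 → ∃ g, (D.comap e).sgn g = s := fun s hs => by
    obtain ⟨g, hg⟩ := hsurj s hs
    exact ⟨e.symm g, by simp [HantzscheWendt.DiagonalAction.comap, hg]⟩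
  have htrans : (D.comap e).translations ⊤ = D.translations ⊤ := by
    ext t
    constructor
    · rintro ⟨g, -, hs, ht⟩
      exact ⟨e g, trivial, hs, ht⟩
    · rintro ⟨g, -, hs, ht⟩
      exact ⟨e.symm g, trivial, by simp [HantzscheWendt.DiagonalAction.comap, hs],
        by simp [HantzscheWendt.DiagonalAction.comap, ht]⟩
  refine ⟨(D.comap e).exists_isStandardGenerators hn htor (fun g => hprod (e g)) hsurj'
    (by rwa [htrans]), fun β hβ => ?_⟩
  have hodd : Odd n := (D.comap e).odd_of_no_involution hn htor hsurj'
  obtain ⟨D', hs, hb, hsq, hker⟩ := hβ.exists_diagonalAction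
  obtain ⟨Φ, hΦ, hfree⟩ := D'.exists_hom_isFreeGroup_ker hn β hs hsq
  refine ⟨Φ, hΦ, ?_, hfree⟩
  have hmem : ∀ i : Fin n, i ≠ ⟨n - 1, by omega⟩ → β i ∈ Φ.range := by
    intro i hi
    have hi' : (i : ℕ) < n - 1 := by
      have h1 := i.isLt
      have h2 : (i : ℕ) ≠ n - 1 := fun h => hi (Fin.ext h)
      omega
    exact ⟨HantzscheWendt.CHW.x ⟨i, hi'⟩, hΦ _⟩
  rw [← MonoidHom.range_eq_top, eq_top_iff, ← hβ.1, Subgroup.closure_le]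
  rintro _ ⟨i, rfl⟩
  by_cases hi : i = ⟨n - 1, by omega⟩
  · rw [hi]
    have h1 := D'.mem_closure_of_ne hn hodd htor β ⟨n - 1, by omega⟩ hs hb hsq hker
    refine (Subgroup.closure_le _).2 ?_ h1
    rintro _ ⟨k, rfl⟩
    exact hmem k k.2
  · exact hmem i hi
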